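/- For a finite simple graph $G$ with $n$ vertices whose adjacency matrix has eigenvalues $\lambda_1,\dots,\lambda_n$, let $S_k(G)=\sum_{i=1}^n\lambda_i^k$. For graphs $G_1,G_2$ with $n$ vertices write $G_1=_sG_2$ if $S_i(G_1)=S_i(G_2)$ for $0\le i\le n-1$; write $G_1\prec_sG_2$ if for some $1\le k\le n-1$ one has $S_i(G_1)=S_i(G_2)$ for $0\le i\le k-1$ and $S_k(G_1)<S_k(G_2)$; and write $G_1\preceq_sG_2$ if $G_1\prec_sG_2$ or $G_1=_sG_2$. Let $4\le p\le q$ be integers and let $\mathscr T^{p,q}$ be the set (up to isomorphism) of trees with a $(p,q)$-bipartition, i.e. whose vertex set is the disjoint union of a set of $p$ (white) and a set of $q$ (black) vertices such that every edge joins a white and a black vertex. Let $B^{k,l}_{p,q}$ be the tree with $p$ white and $q$ black vertices in which one white vertex $r$ is adjacent to all $q$ black vertices and each of the other $p-1$ white vertices is a leaf: $k$ of them are attached to one black vertex, $l$ others are attached one each to $l$ further black vertices, and the remaining $p-1-k-l$ are attached to yet another black vertex. Let $D^{k,l}_{p,q}$ be the tree with $p$ white and $q$ black vertices obtained by the same construction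 with the two colours interchanged (a black vertex is adjacent to all $p$ white vertices, and the other $q-1$ black vertices are leaves, attached in groups of $k$, of $l$ single ones, and of $q-1-k-l$). Put $\mathscr C=\mathscr T^{p,q}\setminus\{B^{0,0}_{p,q},B^{0,1}_{p,q}\}$. **Theorem.** (i) If $p=q$, then every $T\in\mathscr C$ satisfies $T\preceq_s B^{2,0}_{p,q}$, and $T=_sB^{2,0}_{p,q}$ if and only if $T\cong B^{2,0}_{p,q}$. (ii) Suppose $p<q$. If $p>\frac{q+4}{2}$, then every $T\in\mathscr C$ satisfies $T\preceq_s D^{0,1}_{p,q}$, and $T=_sD^{0,1}_{p,q}$ if and only if $T\cong D^{0,1}_{p,q}$. If $p\le\frac{q+4}{2}$, then every $T\in\mathscr C$ satisfies $T\preceq_s B^{2,0}_{p,q}$, and $T=_sB^{2,0}_{p,q}$ if and only if $T\cong B^{2,0}_{p,q}$. Moreover, $B^{2,0}_{p,q}\in\mathscr C$ whenever $p\ge5$, and $D^{0,1}_{p,q}\in\mathscr C$ whenever $p<q$ and $p>\frac{q+4}{2}$; so in these cases the named tree is the unique last element of $\mathscr C$ in the $S$-order. If $p<q$ and $p=\frac{q+4}{2}$,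 then $S_i(D^{0,1}_{p,q})=S_i(B^{2,0}_{p,q})$ for $0\le i\le5$ and $S_6(D^{0,1}_{p,q})<S_6(B^{2,0}_{p,q})$. -/

import Mathlib

namespace SOrder

/-- The `k`-th spectral moment `S_k(G) = ∑ λ_i ^ k`, the sum running over the eigenvalues
(with multiplicity) of the real adjacency matrix of `G`. -/
noncomputable def spectralMoment {V : Type*} [Fintype V] (G : SimpleGraph V) (k : ℕ) : ℝ := by
  classical exact ∑ i, (G.isHermitian_adjMatrix ℝ).eigenvalues i ^ k

/-- `G₁ =ₛ G₂`: both graphs have the same number `n` of vertices and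
`S_i(G₁) = S_i(G₂)` for `i = 0, 1, …, n - 1`. -/
def SEq {V W : Type*} [Fintype V] [Fintype W] (G₁ : SimpleGraph V) (G₂ : SimpleGraph W) : Prop :=
  Fintype.card V = Fintype.card W ∧
    ∀ i, i < Fintype.card V → spectralMoment G₁ i = spectralMoment G₂ i

/-- `G₁ ≺ₛ G₂`: both graphs have the same number `n` of vertices and, for some `1 ≤ k ≤ n - 1`,
`S_i(G₁) = S_i(G₂)` for `i = 0, …, k - 1` and `S_k(G₁) < S_k(G₂)`. -/
def SLt {V W : Type*} [Fintype V] [Fintype W] (G₁ : SimpleGraph V) (G₂ : SimpleGraph W) : Prop :=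
  Fintype.card V = Fintype.card W ∧
    ∃ k, 1 ≤ k ∧ k < Fintype.card V ∧
      (∀ i, i < k → spectralMoment G₁ i = spectralMoment G₂ i) ∧
      spectralMoment G₁ k < spectralMoment G₂ k

/-- `G₁ ⪯ₛ G₂`. -/
def SLe {V W : Type*} [Fintype V] [Fintype W] (G₁ : SimpleGraph V) (G₂ : SimpleGraph W) : Prop :=
  SLt G₁ G₂ ∨ SEq G₁ G₂

/-- The vertex set of `G` splits into two parts with `p` and `q` elements such that
every edge joins the two parts. -/
def HasBipartition {V : Type*} (G : SimpleGraph V) (p q : ℕ) : Prop :=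
  ∃ s : Set V, s.ncard = p ∧ sᶜ.ncard = q ∧ G.IsBipartiteWith s sᶜ

/-- Membership in the class of trees (on `n = p + q` vertices) with a `(p, q)`-bipartition. -/
def IsBipTree {V : Type*} [Fintype V] (p q : ℕ) (T : SimpleGraph V) : Prop :=
  T.IsTree ∧ HasBipartition T p q

/-- The tree `B_{p,q}^{k,l}`, with white vertices `Fin p` and black vertices `Fin q`
(meaningful for `1 + k + l ≤ p` and `l + 2 ≤ q`).
The white vertex `0` is adjacent to all black vertices. Of the other `p - 1` white vertices, all
of which are leaves, the first `k` hang at the black vertex `1`, the next `l` hang one each at the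
black vertices `2, …, l + 1`, and the remaining `p - 1 - k - l` hang at the black vertex `0`. -/
def treeB (p q k l : ℕ) : SimpleGraph (Fin p ⊕ Fin q) :=
  SimpleGraph.fromRel fun x y =>
    match x, y with
    | Sum.inl w, Sum.inr b =>
        w.val = 0 ∨
          b.val = if w.val ≤ k then 1 else if w.val ≤ k + l then w.val - k + 1 else 0
    | _, _ => False

/-- The tree `D_{p,q}^{k,l}`, with white vertices `Fin p` and black vertices `Fin q`: the same
construction with the two colours interchanged, so that the hub adjacent to a whole
colour class is black and is adjacent to all `p` white vertices. -/
def treeD (p q k l : ℕ) : SimpleGraph (Fin p ⊕ Fin q) :=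
  (treeB q p k l).comap Sum.swap

/-- Trees with a `(p, q)`-bipartition other than `B_{p,q}^{0,0}` and `B_{p,q}^{0,1}`,
up to isomorphism. -/
def InClass {V : Type*} [Fintype V] (p q : ℕ) (T : SimpleGraph V) : Prop :=
  IsBipTree p q T ∧ ¬ Nonempty (T ≃g treeB p q 0 0) ∧ ¬ Nonempty (T ≃g treeB p q 0 1)

end SOrder

namespace SOrder

open Finset Matrix

/-! ### Spectral moments as traces; closed forms for orders up to four. -/

section Moments

variable {V W : Type*} [Fintype V] [Fintype W]

/-! Odd moments of a bipartite graph vanish, and `S_0`, `S_2` only count vertices and edges, so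
`S_4` is the first moment that can separate two trees of the class. For a tree, `S_4` equals twice
the sum of the squared excesses `(deg v - 1) ^ 2` plus a constant
(`IsColoredTree.spectralMoment_four`). The excesses have fixed sums, `q - 1` over the white class
and `p - 1` over the black one, so a large `S_4` requires each sum to be concentrated on few
vertices.

Total concentration in a class means a hub, a vertex adjacent to the whole other class. Two hubs
give `B^{0,0}`. With a white hub only, the black excesses are at best `(p-2, 1)`, which is
`B^{0,1}`, and then `(p-3, 2)`, which is `B^{2,0}`; everything else is strictly smaller
(`hub_cases`). A black hub gives the same list with the colours interchanged, and having no hub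
costs too much in both classes (`spectralMoment_four_le_of_no_hub`). Hence only `B^{2,0}` and, for
`p < q`, `D^{0,1}` can be last in the class (`InClass.cases`). Their `S_4` differ by `4 * (q + 4 - 2
* p)`, which is the threshold in the theorem; at a tie `S_6` decides.

The moments of the named trees come from the model `hubGraph`, whose squared adjacency matrix has a
block "all ones plus diagonal". -/

theorem _root_.Matrix.IsHermitian.trace_pow_eq_sum_eigenvalues_pow [DecidableEq V]
    {A : Matrix V V ℝ} (hA : A.IsHermitian) (k : ℕ) :
    (A ^ k).trace = ∑ i, hA.eigenvalues i ^ k := by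
  conv_lhs => rw [hA.spectral_theorem, ← map_pow, Unitary.conjStarAlgAut_apply,
    Matrix.trace_mul_comm, ← mul_assoc]
  simp [Matrix.diagonal_pow, Matrix.trace_diagonal]

theorem spectralMoment_eq_trace [DecidableEq V] (G : SimpleGraph V) [DecidableRel G.Adj] (k : ℕ) :
    spectralMoment G k = ((G.adjMatrix ℝ) ^ k).trace := by
  -- `spectralMoment` is built on the classical instance; quantifying over the instance lets `rfl`
  -- replace the given one.
  have h : ∀ hdec : DecidableRel G.Adj, hdec = Classical.decRel _ →
      spectralMoment G k = ((G.adjMatrix ℝ) ^ k).trace := by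
    rintro _ rfl
    refine Eq.trans ?_ (Matrix.IsHermitian.trace_pow_eq_sum_eigenvalues_pow
      (@SimpleGraph.isHermitian_adjMatrix V ℝ G (Classical.decRel _) _ _) k).symm
    unfold spectralMoment
    congr!
  exact h _ (Subsingleton.elim _ _)

theorem spectralMoment_congr {G : SimpleGraph V} {H : SimpleGraph W} (e : G ≃g H) (k : ℕ) :
    spectralMoment G k = spectralMoment H k := by
  classical
  rw [spectralMoment_eq_trace, spectralMoment_eq_trace, ← e.reindex_adjMatrix ℝ,
    ← Matrix.coe_reindexAlgEquiv ℝ ℝ, ← map_pow, Matrix.coe_reindexAlgEquiv,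
    Matrix.trace, Matrix.trace]
  simp only [Matrix.diag, Matrix.reindex_apply, Matrix.submatrix_apply]
  exact (Equiv.sum_comp e.toEquiv.symm fun i => (G.adjMatrix ℝ ^ k) i i).symm

theorem SEq.of_iso {G : SimpleGraph V} {H : SimpleGraph W} (e : G ≃g H) : SEq G H :=
  ⟨Fintype.card_congr e.toEquiv, fun i _ => spectralMoment_congr e i⟩

theorem SLt.not_sEq {G : SimpleGraph V} {H : SimpleGraph W} (h : SLt G H) : ¬ SEq G H := by
  obtain ⟨-, k, -, hk, -, hlt⟩ := h
  exact fun h' => hlt.ne (h'.2 k hk)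

/-- Conjugation by the diagonal sign matrix `D` of the colouring negates the adjacency matrix, so
the trace of an odd power is its own negative. -/
theorem spectralMoment_odd {G : SimpleGraph V} {s : Set V} (h : G.IsBipartiteWith s sᶜ) {k : ℕ}
    (hk : Odd k) : spectralMoment G k = 0 := by
  classical
  rw [spectralMoment_eq_trace]
  set A := G.adjMatrix ℝ
  set D : Matrix V V ℝ := Matrix.diagonal fun v => if v ∈ s then 1 else -1
  have hDD : D * D = 1 := by
    simp only [D, Matrix.diagonal_mul_diagonal, ← Matrix.diagonal_one]
    congr 1; ext v; split_ifs <;> simp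
  have hDA : D * A = -(A * D) := by
    ext v w
    simp only [D, A, Matrix.diagonal_mul, Matrix.mul_diagonal, Matrix.neg_apply,
      SimpleGraph.adjMatrix_apply]
    by_cases hvw : G.Adj v w
    · rcases h.mem_of_adj hvw with ⟨hv, hw⟩ | ⟨hv, hw⟩
      · have hw' : w ∉ s := hw
        simp [hv, hw', hvw]
      · have hv' : v ∉ s := hv
        simp [hv', hw, hvw]
    · simp [hvw]
  have hpow : ∀ j : ℕ, D * A ^ j = (-1 : ℝ) ^ j • (A ^ j * D) := by
    intro j
    induction j with
    | zero => simp
    | succ j ih =>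
      rw [pow_succ, ← mul_assoc, ih, smul_mul_assoc, mul_assoc, hDA, mul_neg, pow_succ,
        ← mul_assoc]
      simp
  have h1 : (A ^ k).trace = -(A ^ k).trace := by
    conv_lhs => rw [← one_mul (A ^ k), ← hDD, mul_assoc, hpow, hk.neg_one_pow, neg_one_smul,
      mul_neg, Matrix.trace_neg, Matrix.trace_mul_comm, mul_assoc, hDD, mul_one]
  linarith

theorem spectralMoment_zero (G : SimpleGraph V) : spectralMoment G 0 = Fintype.card V := by
  classical
  simp [spectralMoment_eq_trace, Matrix.trace_one]

theorem spectralMoment_two (G : SimpleGraph V) [DecidableRel G.Adj] :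
    spectralMoment G 2 = ∑ v, (G.degree v : ℝ) := by
  classical
  rw [spectralMoment_eq_trace, pow_two, Matrix.trace]
  simp only [Matrix.diag, SimpleGraph.adjMatrix_mul_self_apply_self]

omit [Fintype V] in
theorem _root_.SimpleGraph.IsAcyclic.common_neighbor_unique {G : SimpleGraph V}
    (h : G.IsAcyclic) {u v w w' : V} (huv : u ≠ v) (h1 : G.Adj u w) (h2 : G.Adj w v)
    (h1' : G.Adj u w') (h2' : G.Adj w' v) :
    w = w' := by
  have h3 := (h.subsingleton_path u v).elim
    ⟨.cons h1 (.cons h2 .nil), by simp [h1.ne, h2.ne, huv]⟩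
    ⟨.cons h1' (.cons h2' .nil), by simp [h1'.ne, h2'.ne, huv]⟩
  exact congrArg (fun p => p.1.snd) h3

/-- `S_4` is the sum of the squared entries of `A * A`. In a forest two distinct vertices share at
most one neighbour, so off the diagonal these entries are 0 or 1 and squaring changes nothing; the
plain sum of entries is the sum of squared degrees, and each diagonal entry adds a correction `d ^ 2
- d`. -/
theorem spectralMoment_four {G : SimpleGraph V} [DecidableRel G.Adj] (h : G.IsAcyclic) :
    spectralMoment G 4 = 2 * ∑ v, (G.degree v : ℝ) ^ 2 - ∑ v, (G.degree v : ℝ) := by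
  classical
  rw [spectralMoment_eq_trace]
  set A := G.adjMatrix ℝ with hA
  have hdiag : ∀ v, (A * A) v v = G.degree v := fun v => G.adjMatrix_mul_self_apply_self v
  have hsymm : ∀ u v, (A * A) u v = (A * A) v u := fun u v => by
    have h1 : (A * A)ᵀ = A * A := by
      rw [Matrix.transpose_mul, hA, SimpleGraph.transpose_adjMatrix]
    exact congrFun (congrFun h1 v) u
  have hoff : ∀ u v, u ≠ v → (A * A) u v ^ 2 = (A * A) u v := by
    intro u v huv
    by_cases hex : ∃ w, G.Adj u w ∧ G.Adj w v
    · obtain ⟨w, h1, h2⟩ := hex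
      have : (A * A) u v = 1 := by
        rw [Matrix.mul_apply, Finset.sum_eq_single w]
        · simp [A, h1, h2]
        · intro w' _ hne
          by_contra hcon
          simp only [A, SimpleGraph.adjMatrix_apply, mul_ite, mul_one, mul_zero,
            ite_eq_right_iff, not_forall, one_ne_zero] at hcon
          obtain ⟨h2', h1', -⟩ := hcon
          exact hne (h.common_neighbor_unique huv h1' h2' h1 h2)
        · simp
      simp [this]
    · have : (A * A) u v = 0 := by
        rw [Matrix.mul_apply]
        refine Finset.sum_eq_zero fun w _ => ?_
        by_contra hcon
        simp only [A, SimpleGraph.adjMatrix_apply, mul_ite, mul_one, mul_zero,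
          ite_eq_right_iff, not_forall, one_ne_zero] at hcon
        obtain ⟨h2', h1', -⟩ := hcon
        exact hex ⟨w, h1', h2'⟩
      simp [this]
  have hsum : ∑ u, ∑ v, (A * A) u v = ∑ w, (G.degree w : ℝ) ^ 2 := by
    have h1 : ∀ u v, (A * A) u v = ∑ w, A w u * A w v := fun u v => by
      rw [Matrix.mul_apply]
      refine Finset.sum_congr rfl fun w _ => ?_
      simp [A, SimpleGraph.adjMatrix_apply, G.adj_comm]
    have hdeg : ∀ w, ∑ u, A w u = G.degree w := fun w => by
      simp [A, SimpleGraph.adjMatrix_apply, ← SimpleGraph.card_neighborFinset_eq_degree,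
        SimpleGraph.neighborFinset_eq_filter]
    simp_rw [h1]
    rw [Finset.sum_congr rfl fun u _ => Finset.sum_comm, Finset.sum_comm]
    refine Finset.sum_congr rfl fun w _ => ?_
    rw [pow_two, ← hdeg, Finset.sum_mul_sum]
  have h4 : (A ^ 4).trace = ∑ u, ∑ v, (A * A) u v ^ 2 := by
    rw [show A ^ 4 = (A * A) * (A * A) by noncomm_ring, Matrix.trace]
    refine Finset.sum_congr rfl fun u _ => ?_
    rw [Matrix.diag, Matrix.mul_apply]
    exact Finset.sum_congr rfl fun v _ => by rw [hsymm v u, pow_two]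
  have hrow : ∀ u, ∑ v, (A * A) u v ^ 2
      = ∑ v, (A * A) u v + ((G.degree u : ℝ) ^ 2 - G.degree u) := by
    intro u
    rw [← sub_eq_iff_eq_add', ← Finset.sum_sub_distrib, Finset.sum_eq_single u, hdiag]
    · intro v _ hv
      rw [hoff u v hv.symm, sub_self]
    · simp
  rw [h4, Finset.sum_congr rfl fun u _ => hrow u, Finset.sum_add_distrib, hsum,
    Finset.sum_sub_distrib]
  ring

end Moments

/-! ### Hub graphs and their moments. -/

/-- The graph on `Option W ⊕ B` in which `none` is adjacent to all of `B` and `some w` is a leaf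
hanging at `f w`. -/
def hubGraph {W B : Type*} (f : W → B) : SimpleGraph (Option W ⊕ B) where
  Adj x y := match x, y with
    | .inl none, .inr _ => True
    | .inl (some w), .inr b => f w = b
    | .inr _, .inl none => True
    | .inr b, .inl (some w) => f w = b
    | _, _ => False
  symm := ⟨by rintro ((_ | _) | _) ((_ | _) | _) h <;> simp_all⟩
  loopless := ⟨by rintro ((_ | _) | _) h <;> simp_all⟩

section HubGraph

variable {W B : Type*} (f : W → B)

@[simp] theorem hubGraph_adj_none_inr (b : B) : (hubGraph f).Adj (.inl none) (.inr b) := trivial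

@[simp] theorem hubGraph_adj_inr_none (b : B) : (hubGraph f).Adj (.inr b) (.inl none) := trivial

@[simp] theorem hubGraph_adj_some_inr (w : W) (b : B) :
    (hubGraph f).Adj (.inl (some w)) (.inr b) ↔ f w = b := Iff.rfl

@[simp] theorem hubGraph_adj_inr_some (w : W) (b : B) :
    (hubGraph f).Adj (.inr b) (.inl (some w)) ↔ f w = b := Iff.rfl

@[simp] theorem hubGraph_not_adj_inl (w w' : Option W) :
    ¬ (hubGraph f).Adj (.inl w) (.inl w') := by
  rcases w with _ | w <;> rcases w' with _ | w' <;> exact id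

@[simp] theorem hubGraph_not_adj_inr (b b' : B) : ¬ (hubGraph f).Adj (.inr b) (.inr b') := id

variable [Fintype W] [Fintype B]

/-- The number of points in the fibre of `f` over `b`. -/
noncomputable def fiberCard (b : B) : ℕ := Nat.card {w // f w = b}

omit [Fintype B] in
theorem fiberCard_eq_card [DecidableEq B] (b : B) :
    fiberCard f b = #{w | f w = b} := by
  rw [fiberCard, Nat.card_eq_fintype_card, Fintype.card_subtype]

theorem sum_fiberCard : ∑ b, fiberCard f b = Fintype.card W := by
  classical
  simp_rw [fiberCard_eq_card]
  exact (Finset.card_eq_sum_card_fiberwise fun _ _ => Finset.mem_univ _).symm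

/-- Half the moment of order `2 j` of `hubGraph f` is the trace of the `j`-th power of a rank-one
perturbation of a diagonal matrix. -/
theorem spectralMoment_hubGraph_even [DecidableEq B] (j : ℕ) :
    spectralMoment (hubGraph f) (2 * (j + 1)) =
      2 * ((Matrix.of (fun _ _ => 1) + Matrix.diagonal (fun b => (fiberCard f b : ℝ)) :
        Matrix B B ℝ) ^ (j + 1)).trace := by
  classical
  rw [spectralMoment_eq_trace]
  -- `M` is the biadjacency matrix. Even powers of `A` are block diagonal in `M * Mᵀ` and `Mᵀ * M`,
  -- whose positive powers have equal traces; this accounts for the factor 2 and the exponent `j +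
  -- 1`.
  set M : Matrix (Option W) B ℝ :=
    Matrix.of fun w b => w.elim 1 fun w => if f w = b then 1 else 0 with hM
  have hA : (hubGraph f).adjMatrix ℝ = Matrix.fromBlocks 0 M Mᵀ 0 := by
    ext ((_ | _) | _) ((_ | _) | _) <;> simp [M, SimpleGraph.adjMatrix_apply]
  have hG : Mᵀ * M = Matrix.of (fun _ _ => 1) + Matrix.diagonal (fun b => (fiberCard f b : ℝ)) := by
    ext b b'
    rw [Matrix.mul_apply, Fintype.sum_option]
    by_cases hb : b = b'
    · subst hb
      simp [M, fiberCard_eq_card, ← ite_and]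
    · simp [M, hb, Finset.sum_ite, Finset.filter_filter]
      rintro w rfl; exact Ne.symm hb
  have hpow : ∀ j : ℕ, (Matrix.fromBlocks 0 M Mᵀ 0) ^ (2 * j) =
      Matrix.fromBlocks ((M * Mᵀ) ^ j) 0 0 ((Mᵀ * M) ^ j) := by
    intro j
    rw [pow_mul, pow_two, Matrix.fromBlocks_multiply]
    induction j with
    | zero => simp [Matrix.fromBlocks_one]
    | succ j ih => rw [pow_succ, ih, Matrix.fromBlocks_multiply]; simp [pow_succ]
  have hcomm : ∀ j : ℕ, (M * Mᵀ) ^ (j + 1) = M * ((Mᵀ * M) ^ j * Mᵀ) := by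
    intro j
    induction j with
    | zero => simp
    | succ j ih => rw [pow_succ, ih, pow_succ]; simp only [Matrix.mul_assoc]
  have htr : ∀ (X : Matrix (Option W) (Option W) ℝ) (Y : Matrix B B ℝ),
      (Matrix.fromBlocks X 0 0 Y).trace = X.trace + Y.trace := fun X Y => by
    simp [Matrix.trace, Fintype.sum_sum_type]
  rw [hA, hpow, htr, hcomm, Matrix.trace_mul_comm, Matrix.mul_assoc, ← pow_succ,
    hG, two_mul]

theorem spectralMoment_hubGraph_two :
    spectralMoment (hubGraph f) 2 = 2 * (Fintype.card B + Fintype.card W) := by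
  classical
  rw [spectralMoment_hubGraph_even f 0, ← sum_fiberCard f]
  simp [Matrix.trace, Finset.sum_add_distrib]

theorem spectralMoment_hubGraph_four :
    spectralMoment (hubGraph f) 4 = 2 * ((Fintype.card B : ℝ) ^ 2 + 2 * Fintype.card W +
      ∑ b, (fiberCard f b : ℝ) ^ 2) := by
  classical
  rw [spectralMoment_hubGraph_even f 1, ← sum_fiberCard f]
  simp [Matrix.trace, Finset.sum_add_distrib, pow_two, Matrix.mul_apply, Matrix.add_apply,
    Matrix.diagonal_apply, add_mul, mul_add]
  ring

theorem spectralMoment_hubGraph_six :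
    spectralMoment (hubGraph f) 6 = 2 * ((Fintype.card B : ℝ) ^ 3 +
      3 * Fintype.card B * Fintype.card W + 3 * ∑ b, (fiberCard f b : ℝ) ^ 2 +
      ∑ b, (fiberCard f b : ℝ) ^ 3) := by
  classical
  rw [spectralMoment_hubGraph_even f 2, ← sum_fiberCard f]
  simp [Matrix.trace, Finset.sum_add_distrib, pow_succ, Matrix.mul_apply, Matrix.add_apply,
    Matrix.diagonal_apply, add_mul, mul_add, ← Finset.mul_sum]
  ring

theorem hubGraph_isTree [Nonempty B] : (hubGraph f).IsTree := by
  classical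
  have hreach : ∀ x, (hubGraph f).Reachable x (.inl none) := by
    have hB : ∀ b, (hubGraph f).Reachable (.inr b) (.inl none) := fun b =>
      SimpleGraph.Adj.reachable (by simp)
    rintro ((_ | w) | b)
    · rfl
    · exact (SimpleGraph.Adj.reachable (by simp : (hubGraph f).Adj _ (.inr (f w)))).trans (hB _)
    · exact hB b
  rw [SimpleGraph.isTree_iff_connected_and_card]
  refine ⟨(SimpleGraph.connected_iff_exists_forall_reachable _).2
    ⟨_, fun x => (hreach x).symm⟩, ?_⟩
  -- The edge count is read off from `S_2`, already computed from the matrix.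
  have h2 := spectralMoment_two (hubGraph f)
  rw [spectralMoment_hubGraph_two, ← Nat.cast_sum,
    SimpleGraph.sum_degrees_eq_twice_card_edges] at h2
  have h3 : 2 * (Fintype.card B + Fintype.card W) = 2 * #(hubGraph f).edgeFinset := by
    exact_mod_cast h2
  rw [Nat.card_eq_fintype_card, ← SimpleGraph.edgeFinset_card, Nat.card_eq_fintype_card,
    Fintype.card_sum, Fintype.card_option]
  omega

end HubGraph

/-! ### Isomorphisms between hub graphs. -/

section HubIso

variable {W B W' B' : Type*}

/-- Compatible bijections of the leaves and of the second colour class induce an isomorphism. -/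
def hubGraphIso {f : W → B} {g : W' → B'} (α : W ≃ W') (β : B ≃ B')
    (h : ∀ w, β (f w) = g (α w)) : hubGraph f ≃g hubGraph g where
  toEquiv := Equiv.sumCongr (Equiv.optionCongr α) β
  map_rel_iff' := by
    rintro ((_ | w) | b) ((_ | w') | b') <;> simp [← h]

variable [Fintype W] [Fintype B] [Fintype W'] [Fintype B']

/-- When all leaves hang at two points, the sizes of the classes and of one fibre determine the
other fibre, hence the graph. -/
theorem exists_hubGraphIso {f : W → B} {g : W' → B'} {b₁ b₂ : B} {c₁ c₂ : B'} (hb : b₁ ≠ b₂)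
    (hc : c₁ ≠ c₂) (hf : ∀ w, f w = b₁ ∨ f w = b₂) (hg : ∀ w, g w = c₁ ∨ g w = c₂)
    (hW : Fintype.card W = Fintype.card W') (hB : Fintype.card B = Fintype.card B')
    (h₂ : fiberCard f b₂ = fiberCard g c₂) : Nonempty (hubGraph f ≃g hubGraph g) := by
  classical
  obtain ⟨β, hβ₁, hβ₂⟩ : ∃ β : B ≃ B', β b₁ = c₁ ∧ β b₂ = c₂ := by
    let β₀ := Fintype.equivOfCardEq hB
    let β₁ := β₀.trans (Equiv.swap (β₀ b₁) c₁)
    have h1 : β₁ b₁ = c₁ := by simp [β₁]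
    -- The second swap keeps `c₁` fixed, since neither `β₁ b₂` nor `c₂` equals it.
    refine ⟨β₁.trans (Equiv.swap (β₁ b₂) c₂), ?_, by simp⟩
    rw [Equiv.trans_apply, h1, Equiv.swap_apply_of_ne_of_ne _ hc]
    rw [← h1]
    exact fun h => hb (β₁.injective h)
  rw [fiberCard, fiberCard, Nat.card_eq_fintype_card, Nat.card_eq_fintype_card] at h₂
  let e₂ := Fintype.equivOfCardEq h₂
  have h₁ : Fintype.card {w // ¬ f w = b₂} = Fintype.card {w // ¬ g w = c₂} := by
    rw [Fintype.card_subtype_compl, Fintype.card_subtype_compl, hW, h₂]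
  let e₁ := Fintype.equivOfCardEq h₁
  refine ⟨hubGraphIso ((Equiv.sumCompl _).symm.trans ((e₂.sumCongr e₁).trans (Equiv.sumCompl _)))
    β fun w => ?_⟩
  by_cases hw : f w = b₂
  · have h3 := (e₂ ⟨w, hw⟩).2
    simp [h3, hw, hβ₂]
  · have h3 := (hg (e₁ ⟨w, hw⟩)).resolve_right (e₁ ⟨w, hw⟩).2
    rw [Equiv.trans_apply, Equiv.trans_apply,
      Equiv.sumCompl_symm_apply_of_neg (p := fun a => f a = b₂) hw]
    simp [h3, (hf w).resolve_right hw, hβ₁]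

omit [Fintype B] in
theorem fiberCard_eq_zero {f : W → B} {b : B} (h : ∀ w, f w ≠ b) : fiberCard f b = 0 := by
  classical
  rw [fiberCard_eq_card, Finset.card_eq_zero, Finset.filter_eq_empty_iff]
  exact fun w _ => h w

theorem sum_fiberCard_pow {f : W → B} {b₁ b₂ : B} (hb : b₁ ≠ b₂)
    (hf : ∀ w, f w = b₁ ∨ f w = b₂) (e : ℕ) :
    ∑ b, fiberCard f b ^ (e + 1) = fiberCard f b₁ ^ (e + 1) + fiberCard f b₂ ^ (e + 1) := by
  classical
  refine Finset.sum_eq_add b₁ b₂ hb (fun b _ h => ?_) (by simp) (by simp)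
  rw [fiberCard_eq_zero fun w hw => ?_, zero_pow e.succ_ne_zero]
  rcases hf w with h' | h'
  · exact h.1 (hw.symm.trans h')
  · exact h.2 (hw.symm.trans h')

theorem fiberCard_add_fiberCard {f : W → B} {b₁ b₂ : B} (hb : b₁ ≠ b₂)
    (hf : ∀ w, f w = b₁ ∨ f w = b₂) : fiberCard f b₁ + fiberCard f b₂ = Fintype.card W := by
  rw [← sum_fiberCard f]
  simpa using (sum_fiberCard_pow hb hf 0).symm

theorem degree_hubGraph_inr (f : W → B) (b : B) [DecidableRel (hubGraph f).Adj] :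
    (hubGraph f).degree (.inr b) = fiberCard f b + 1 := by
  classical
  have h := (hubGraph f).degree_eq_sum_if_adj (R := ℕ) (.inr b)
  rw [Fintype.sum_sum_type, Fintype.sum_option] at h
  simpa [fiberCard_eq_card, add_comm] using h

end HubIso

/-! ### The trees `treeB` and `treeD` as hub graphs. -/

section TreeB

theorem treeB_iso_hubGraph {P q k l : ℕ} (g : Fin P → Fin q)
    (hg : ∀ w, (g w).val = if w.val + 1 ≤ k then 1 else if w.val + 1 ≤ k + l then
      w.val + 1 - k + 1 else 0) : Nonempty (treeB (P + 1) q k l ≃g hubGraph g) := by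
  refine ⟨⟨Equiv.sumCongr (finSuccEquiv P) (Equiv.refl _), ?_⟩⟩
  rintro (w | b) (w' | b')
  · simp [treeB]
  · refine Fin.cases ?_ (fun w => ?_) w
    · simp [treeB]
    · simp only [treeB, SimpleGraph.fromRel_adj, Fin.val_succ, ← hg, ← Fin.ext_iff,
        Equiv.sumCongr_apply, Sum.map_inl, Sum.map_inr, finSuccEquiv_succ, Equiv.refl_apply,
        hubGraph_adj_some_inr]
      simp [eq_comm]
  · refine Fin.cases ?_ (fun w => ?_) w'
    · simp [treeB]
    · simp only [treeB, SimpleGraph.fromRel_adj, Fin.val_succ, ← hg, ← Fin.ext_iff,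
        Equiv.sumCongr_apply, Sum.map_inl, Sum.map_inr, finSuccEquiv_succ, Equiv.refl_apply,
        hubGraph_adj_inr_some]
      simp [eq_comm]
  · simp [treeB]

/-- The conditions on `k` and `l` cover `B^{k,0}` and `B^{0,1}`, exactly the shapes where at most
two black vertices carry leaves. -/
theorem exists_treeB_iso_hubGraph {p q k l : ℕ} (hp : 1 + k + l ≤ p) (hq : l + 2 ≤ q)
    (hl : l ≤ 1) (hkl : k = 0 ∨ l = 0) :
    ∃ (g : Fin (p - 1) → Fin q) (c₁ c₂ : Fin q), c₁ ≠ c₂ ∧ (∀ w, g w = c₁ ∨ g w = c₂) ∧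
      fiberCard g c₂ = k + l ∧ Nonempty (treeB p q k l ≃g hubGraph g) := by
  obtain ⟨P, rfl⟩ : ∃ P, p = P + 1 := ⟨p - 1, by omega⟩
  have hlt : ∀ w : Fin P, (if w.val + 1 ≤ k then 1 else if w.val + 1 ≤ k + l then
      w.val + 1 - k + 1 else 0) < q := fun w => by split_ifs <;> omega
  -- The second carrier is black vertex 1 when `l = 0` and black vertex 2 when `k = 0`, `l = 1`;
  -- both are `l + 1`.
  refine ⟨fun w => ⟨_, hlt w⟩, ⟨0, by omega⟩, ⟨l + 1, by omega⟩, by simp, fun w => ?_, ?_,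
    treeB_iso_hubGraph _ fun _ => rfl⟩
  · simp only [Fin.ext_iff]
    split_ifs <;> omega
  · have hiff : ∀ w : Fin P, (⟨_, hlt w⟩ : Fin q) = ⟨l + 1, by omega⟩ ↔ w.val < k + l := by
      intro w
      simp only [Fin.ext_iff]
      split_ifs
      · omega
      · omega
      · rw [false_iff]; omega
    rw [fiberCard_eq_card]
    simp only [hiff]
    rw [Fin.card_filter_val_lt]
    exact min_eq_right (by omega)

theorem treeB_isTree {p q k l : ℕ} (hp : 1 + k + l ≤ p) (hq : l + 2 ≤ q)
    (hl : l ≤ 1) (hkl : k = 0 ∨ l = 0) : (treeB p q k l).IsTree := by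
  obtain ⟨g, c₁, -, -, -, -, ⟨e⟩⟩ := exists_treeB_iso_hubGraph hp hq hl hkl
  have : Nonempty (Fin q) := ⟨c₁⟩
  exact e.isTree_iff.2 (hubGraph_isTree g)

theorem hasBipartition_treeB (p q k l : ℕ) : HasBipartition (treeB p q k l) p q := by
  refine ⟨Set.range Sum.inl, ?_, ?_, disjoint_compl_right, ?_⟩
  · rw [← Set.image_univ, Set.ncard_image_of_injective _ Sum.inl_injective]
    simp
  · rw [Set.compl_range_inl, ← Set.image_univ, Set.ncard_image_of_injective _ Sum.inr_injective]
    simp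
  · rintro (x | x) (y | y) h <;> simp_all [treeB]

/-- Interchanging the colours. -/
def treeDIso (p q k l : ℕ) : treeD p q k l ≃g treeB q p k l where
  toEquiv := Equiv.sumComm _ _
  map_rel_iff' := Iff.rfl

theorem HasBipartition.symm {V : Type*} {G : SimpleGraph V} {p q : ℕ} (h : HasBipartition G p q) :
    HasBipartition G q p := by
  obtain ⟨s, hp, hq, h⟩ := h
  exact ⟨sᶜ, hq, by rwa [compl_compl], by rw [compl_compl]; exact h.symm⟩

theorem HasBipartition.of_iso {V W : Type*} {G : SimpleGraph V} {H : SimpleGraph W} {p q : ℕ}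
    (e : G ≃g H) (h : HasBipartition H p q) : HasBipartition G p q := by
  obtain ⟨s, hp, hq, h⟩ := h
  refine ⟨e ⁻¹' s, ?_, ?_, disjoint_compl_right, fun v w hvw => h.mem_of_adj (e.map_adj_iff.2 hvw)⟩
  · rw [← hp]
    exact Set.ncard_preimage_of_injective_subset_range e.injective fun x _ => e.surjective x
  · rw [← hq, ← Set.preimage_compl]
    exact Set.ncard_preimage_of_injective_subset_range e.injective fun x _ => e.surjective x

theorem HasBipartition.spectralMoment_odd {V : Type*} [Fintype V] {G : SimpleGraph V} {p q : ℕ}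
    (h : HasBipartition G p q) {k : ℕ} (hk : Odd k) : spectralMoment G k = 0 := by
  obtain ⟨s, -, -, h⟩ := h
  exact SOrder.spectralMoment_odd h hk

variable {p q k l : ℕ} (hp : 1 + k + l ≤ p) (hq : l + 2 ≤ q) (hl : l ≤ 1) (hkl : k = 0 ∨ l = 0)
include hp hq hl hkl

theorem spectralMoment_treeB_four :
    spectralMoment (treeB p q k l) 4 = 2 * ((q : ℝ) ^ 2 + 2 * (p - 1 : ℝ) +
      ((p - 1 - (k + l) : ℝ) ^ 2 + (k + l : ℝ) ^ 2)) := by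
  obtain ⟨g, c₁, c₂, hc, hg, hcard, ⟨e⟩⟩ := exists_treeB_iso_hubGraph hp hq hl hkl
  have h1 := fiberCard_add_fiberCard hc hg
  have h2 := sum_fiberCard_pow hc hg 1
  rw [hcard, Fintype.card_fin] at h1
  have h1' : fiberCard g c₁ = p - 1 - (k + l) := by omega
  rw [spectralMoment_congr e, spectralMoment_hubGraph_four]
  have h3 : ∑ b, (fiberCard g b : ℝ) ^ 2 = (p - 1 - (k + l) : ℝ) ^ 2 + (k + l : ℝ) ^ 2 := by
    rw [hcard, h1'] at h2
    have : ((∑ b, fiberCard g b ^ 2 : ℕ) : ℝ) = ((p - 1 - (k + l) : ℕ) ^ 2 + (k + l) ^ 2 : ℕ) := by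
      rw [h2]
    rw [Nat.sub_sub, Nat.cast_add, Nat.cast_pow, Nat.cast_sub (by omega)] at this
    push_cast at this
    rw [this]; ring
  rw [h3, Fintype.card_fin, Fintype.card_fin, Nat.cast_sub (by omega)]
  simp

theorem spectralMoment_treeB_six :
    spectralMoment (treeB p q k l) 6 = 2 * ((q : ℝ) ^ 3 + 3 * q * (p - 1 : ℝ) +
      3 * ((p - 1 - (k + l) : ℝ) ^ 2 + (k + l : ℝ) ^ 2) +
      ((p - 1 - (k + l) : ℝ) ^ 3 + (k + l : ℝ) ^ 3)) := by
  obtain ⟨g, c₁, c₂, hc, hg, hcard, ⟨e⟩⟩ := exists_treeB_iso_hubGraph hp hq hl hkl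
  have h1 := fiberCard_add_fiberCard hc hg
  rw [hcard, Fintype.card_fin] at h1
  have h1' : (fiberCard g c₁ : ℝ) = p - 1 - (k + l) := by
    rw [show fiberCard g c₁ = p - (1 + (k + l)) by omega, Nat.cast_sub (by omega)]
    push_cast; ring
  rw [spectralMoment_congr e, spectralMoment_hubGraph_six]
  have h2 := fun e => congrArg (Nat.cast (R := ℝ)) (sum_fiberCard_pow hc hg e)
  simp only [hcard, Nat.cast_sum, Nat.cast_add, Nat.cast_pow, h1'] at h2
  rw [h2 1, h2 2, Fintype.card_fin, Fintype.card_fin, Nat.cast_sub (by omega)]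
  simp

end TreeB

/-! ### Recognising a hub graph inside a bipartite graph. -/

section Hub

variable {V : Type*} [Fintype V] {T : SimpleGraph V} {s : Set V} {r : V}

/-- A bipartite graph in which `r ∈ s` is adjacent to the whole other colour class and every other
vertex of `s` is a leaf is a hub graph. -/
theorem exists_iso_hubGraph [DecidableRel T.Adj] (h : T.IsBipartiteWith s sᶜ) (hr : r ∈ s)
    (hhub : ∀ b ∉ s, T.Adj r b) (hleaf : ∀ w ∈ s, w ≠ r → T.degree w = 1) :
    ∃ (f : {w // w ∈ s ∧ w ≠ r} → {b // b ∉ s}), Nonempty (T ≃g hubGraph f) ∧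
      ∀ b, fiberCard f b + 1 = T.degree b := by
  classical
  have hex : ∀ w : {w // w ∈ s ∧ w ≠ r}, ∃ b : {b // b ∉ s}, ∀ v, T.Adj w v ↔ b.1 = v := by
    rintro ⟨w, hw, hwr⟩
    obtain ⟨b, hb, huniq⟩ := SimpleGraph.degree_eq_one_iff_existsUnique_adj.1 (hleaf w hw hwr)
    have hbs : b ∉ s := (h.mem_of_adj hb).elim (fun h => h.2) fun h => absurd hw h.1
    exact ⟨⟨b, hbs⟩, fun v => ⟨fun hv => (huniq v hv).symm, by rintro rfl; exact hb⟩⟩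
  choose f hf using hex
  have hs : ∀ v w, T.Adj v w → v ∈ s → w ∉ s := fun v w hvw hv =>
    (h.mem_of_adj hvw).elim (fun h => h.2) fun h => absurd hv h.1
  have hsc : ∀ v w, T.Adj v w → v ∉ s → w ∈ s := fun v w hvw hv =>
    (h.mem_of_adj hvw).elim (fun h => absurd h.1 hv) fun h => h.2
  let φ : Option {w // w ∈ s ∧ w ≠ r} ⊕ {b // b ∉ s} → V :=
    Sum.elim (fun w => w.elim r Subtype.val) Subtype.val
  have hφ : Function.Bijective φ := by
    constructor
    · rintro ((_ | ⟨w, hw, hwr⟩) | ⟨b, hb⟩) ((_ | ⟨w', hw', hwr'⟩) | ⟨b', hb'⟩) heq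
      all_goals simp only [φ, Sum.elim_inl, Sum.elim_inr, Option.elim] at heq
      all_goals first | rfl | (subst heq; first | rfl | contradiction)
    · intro v
      by_cases hv : v ∈ s
      · by_cases hvr : v = r
        · exact ⟨.inl none, hvr.symm⟩
        · exact ⟨.inl (some ⟨v, hv, hvr⟩), rfl⟩
      · exact ⟨.inr ⟨v, hv⟩, rfl⟩
  let e : hubGraph f ≃g T := ⟨Equiv.ofBijective φ hφ, by
    rintro ((_ | w) | b) ((_ | w') | b')
    all_goals simp only [φ, Equiv.ofBijective_apply, Sum.elim_inl, Sum.elim_inr, Option.elim,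
      hubGraph_adj_none_inr, hubGraph_adj_inr_none, hubGraph_adj_some_inr, hubGraph_adj_inr_some,
      hubGraph_not_adj_inl, hubGraph_not_adj_inr, iff_true, iff_false]
    · exact T.irrefl
    · exact fun hadj => hs _ _ hadj hr w'.2.1
    · exact hhub _ b'.2
    · exact fun hadj => hs _ _ hadj w.2.1 hr
    · exact fun hadj => hs _ _ hadj w.2.1 w'.2.1
    · rw [hf, Subtype.ext_iff]
    · exact (hhub _ b.2).symm
    · rw [T.adj_comm, hf, Subtype.ext_iff]
    · exact fun hadj => b'.2 (hsc _ _ hadj b.2)⟩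
  refine ⟨f, ⟨e.symm⟩, fun b => ?_⟩
  rw [← degree_hubGraph_inr]
  exact (e.degree_eq (.inr b)).symm

theorem nonempty_iso_treeB [DecidableRel T.Adj] {p q k l : ℕ} (h : T.IsBipartiteWith s sᶜ)
    (hs : s.ncard = p) (hsc : sᶜ.ncard = q) (hr : r ∈ s)
    (hhub : ∀ b ∉ s, T.Adj r b) (hleaf : ∀ w ∈ s, w ≠ r → T.degree w = 1) {b₁ b₂ : V}
    (hb₁ : b₁ ∉ s) (hb₂ : b₂ ∉ s) (hb : b₁ ≠ b₂) (hdeg₂ : T.degree b₂ = k + l + 1)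
    (hdeg : ∀ b ∉ s, b ≠ b₁ → b ≠ b₂ → T.degree b = 1)
    (hp : 1 + k + l ≤ p) (hq : l + 2 ≤ q) (hl : l ≤ 1) (hkl : k = 0 ∨ l = 0) :
    Nonempty (T ≃g treeB p q k l) := by
  classical
  obtain ⟨f, ⟨e⟩, hf⟩ := exists_iso_hubGraph h hr hhub hleaf
  obtain ⟨g, c₁, c₂, hc, hg, hcard, ⟨e'⟩⟩ := exists_treeB_iso_hubGraph hp hq hl hkl
  have h1 : ∀ w, f w = ⟨b₁, hb₁⟩ ∨ f w = ⟨b₂, hb₂⟩ := by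
    intro w
    by_contra! hcon
    have h2 := hdeg _ (f w).2 (fun h => hcon.1 (Subtype.ext h)) fun h => hcon.2 (Subtype.ext h)
    have h3 : fiberCard f (f w) = 0 := by
      have := hf (f w); omega
    rw [fiberCard_eq_card, Finset.card_eq_zero, Finset.filter_eq_empty_iff] at h3
    exact h3 (Finset.mem_univ w) rfl
  have hW : Fintype.card {w // w ∈ s ∧ w ≠ r} = Fintype.card (Fin (p - 1)) := by
    rw [Fintype.card_fin, ← hs, ← Set.ncard_sdiff_singleton_of_mem hr, ← Nat.card_eq_fintype_card]
    rfl
  have hB : Fintype.card {b // b ∉ s} = Fintype.card (Fin q) := by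
    rw [Fintype.card_fin, ← hsc, ← Nat.card_eq_fintype_card]
    rfl
  obtain ⟨e''⟩ := exists_hubGraphIso (b₁ := ⟨b₁, hb₁⟩) (b₂ := ⟨b₂, hb₂⟩) (by simpa using hb) hc h1 hg
    hW hB (by have := hf ⟨b₂, hb₂⟩; simp only at this; omega)
  exact ⟨e.trans (e''.trans e'.symm)⟩

end Hub

/-! ### Sums of squares of natural numbers with a given sum. -/

section SumSq

variable {ι : Type*} {t : Finset ι} {x : ι → ℕ}

theorem sum_sq_le_sq_sum (t : Finset ι) (x : ι → ℕ) : ∑ i ∈ t, x i ^ 2 ≤ (∑ i ∈ t, x i) ^ 2 := by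
  rw [pow_two, Finset.sum_mul]
  refine Finset.sum_le_sum fun i hi => ?_
  rw [pow_two]
  exact Nat.mul_le_mul_left _ (Finset.single_le_sum (fun _ _ => Nat.zero_le _) hi)

/-- Equality case of `sum_sq_le_sq_sum`: a nonzero entry together with a nonzero remainder would
contribute a positive cross term. -/
theorem exists_eq_of_sum_sq_eq {c : ℕ} (hc : 0 < c) (h : ∑ i ∈ t, x i = c)
    (h2 : ∑ i ∈ t, x i ^ 2 = c ^ 2) : ∃ j ∈ t, x j = c ∧ ∀ i ∈ t, i ≠ j → x i = 0 := by
  classical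
  obtain ⟨j, hj, hj0⟩ : ∃ j ∈ t, x j ≠ 0 := by
    by_contra! hcon
    rw [Finset.sum_eq_zero hcon] at h
    omega
  have h1 := Finset.add_sum_erase t x hj
  have h3 := Finset.add_sum_erase t (fun i => x i ^ 2) hj
  have h4 := sum_sq_le_sq_sum (t.erase j) x
  set R := ∑ i ∈ t.erase j, x i with hR
  have hR0 : R = 0 := by
    by_contra hne
    have h5 : 0 < x j * R := Nat.mul_pos (Nat.pos_of_ne_zero hj0) (Nat.pos_of_ne_zero hne)
    rw [← h, ← h1] at h2
    nlinarith
  refine ⟨j, hj, by omega, fun i hi hij => ?_⟩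
  exact Finset.sum_eq_zero_iff.1 (hR.symm.trans hR0) i (Finset.mem_erase.2 ⟨hij, hi⟩)

theorem sum_sq_le_add {i : ι} {a b : ℕ} (hi : i ∈ t) (hxi : x i = a) (h : ∑ i ∈ t, x i = a + b) :
    ∑ i ∈ t, x i ^ 2 ≤ a ^ 2 + b ^ 2 := by
  classical
  have h1 := Finset.add_sum_erase t x hi
  have h3 := Finset.add_sum_erase t (fun i => x i ^ 2) hi
  have h4 := sum_sq_le_sq_sum (t.erase i) x
  have h5 : ∑ i ∈ t.erase i, x i = b := by omega
  rw [h5] at h4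
  rw [← h3, hxi]
  omega

theorem exists_max_of_sum_pos {c : ℕ} (hc : 0 < c) (h : ∑ i ∈ t, x i = c) :
    ∃ i ∈ t, 0 < x i ∧ ∀ j ∈ t, x j ≤ x i := by
  have hne : t.Nonempty := by
    by_contra hcon
    rw [Finset.not_nonempty_iff_eq_empty] at hcon
    subst hcon
    simp at h; omega
  obtain ⟨i, hi, hmax⟩ := t.exists_max_image x hne
  refine ⟨i, hi, Nat.pos_of_ne_zero fun h0 => ?_, hmax⟩
  rw [Finset.sum_eq_zero fun j hj => Nat.le_zero.1 ((hmax j hj).trans h0.le)] at h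
  omega

/-- The extremal pattern is `(M, 1)`. Splitting off one entry `a + 1` and merging the rest into `b +
1` leaves a slack of `2 * a * b`. -/
theorem sum_sq_le_of_le_sub_one {M : ℕ} (h : ∑ i ∈ t, x i = M + 1) (hle : ∀ i ∈ t, x i ≤ M) :
    ∑ i ∈ t, x i ^ 2 ≤ M ^ 2 + 1 := by
  obtain ⟨i, hi, hpos, -⟩ := exists_max_of_sum_pos M.succ_pos h
  obtain ⟨a, ha⟩ : ∃ a, x i = a + 1 := ⟨x i - 1, by omega⟩
  obtain ⟨b, hb⟩ : ∃ b, M = a + 1 + b := ⟨M - (a + 1), by have := hle i hi; omega⟩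
  have := sum_sq_le_add hi ha (b := b + 1) (by omega)
  subst hb
  nlinarith [Nat.zero_le (a * b)]

/-- The extremal pattern is `(M, 2)`. The second alternative records only its shape, which is all
that identifying the tree requires. -/
theorem sum_sq_le_of_le_sub_two {M : ℕ} (hM : 1 ≤ M) (h : ∑ i ∈ t, x i = M + 2)
    (hle : ∀ i ∈ t, x i ≤ M) : ∑ i ∈ t, x i ^ 2 < M ^ 2 + 4 ∨
      ∃ i ∈ t, ∃ j ∈ t, i ≠ j ∧ x j = 2 ∧ ∀ k ∈ t, k ≠ i → k ≠ j → x k = 0 := by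
  classical
  obtain ⟨i, hi, hpos, hmax⟩ := exists_max_of_sum_pos (Nat.succ_pos _) h
  rcases (hle i hi).eq_or_lt with hiM | hiM
  · have h2 := sum_sq_le_add hi hiM h
    rcases h2.lt_or_eq with h2 | h2
    · exact Or.inl h2
    · right
      have h1 := Finset.add_sum_erase t x hi
      have h3 := Finset.add_sum_erase t (fun i => x i ^ 2) hi
      simp only [h2, hiM] at h3
      obtain ⟨j, hj, hj2, hj0⟩ := exists_eq_of_sum_sq_eq (t := t.erase i) (x := x) (c := 2)
        (by omega) (by omega) (by omega)
      rw [Finset.mem_erase] at hj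
      exact ⟨i, hi, j, hj.2, hj.1.symm, hj2, fun k hk hki hkj =>
        hj0 k (Finset.mem_erase.2 ⟨hki, hk⟩) hkj⟩
  · left
    -- Merging all entries but the maximum leaves a slack of `2 * (x i - 2) * (b + 1)`, positive
    -- only for `x i ≥ 3`; smaller maxima use the bound "maximum times sum" instead.
    obtain ⟨b, hb⟩ : ∃ b, M = x i + 1 + b := ⟨M - (x i + 1), by omega⟩
    by_cases ha : 3 ≤ x i
    · obtain ⟨a, ha⟩ : ∃ a, x i = a + 3 := ⟨x i - 3, by omega⟩
      have := sum_sq_le_add hi ha (b := b + 3) (by omega)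
      rw [ha] at hb
      subst hb
      nlinarith [Nat.zero_le (a * b)]
    · have h2 : ∑ k ∈ t, x k ^ 2 ≤ x i * (M + 2) := by
        rw [← h, Finset.mul_sum]
        refine Finset.sum_le_sum fun k hk => ?_
        rw [pow_two]
        exact Nat.mul_le_mul_right _ (hmax k hk)
      have : x i = 1 ∨ x i = 2 := by omega
      rcases this with h1 | h1 <;> rw [h1] at h2 hb <;> subst hb <;> nlinarith

end SumSq

/-! ### Degree excesses and the fourth moment of a coloured tree. -/

section BipTree

variable {V : Type*} [Fintype V]

/-- `T` is a tree with colour classes `s` and `t`. -/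
structure IsColoredTree (T : SimpleGraph V) (s t : Finset V) : Prop where
  isTree : T.IsTree
  mem_iff : ∀ v, v ∈ t ↔ v ∉ s
  isBipartiteWith : T.IsBipartiteWith s t

theorem IsBipTree.exists_isColoredTree {T : SimpleGraph V} {p q : ℕ} (h : IsBipTree p q T) :
    ∃ s t : Finset V, IsColoredTree T s t ∧ #s = p ∧ #t = q := by
  classical
  obtain ⟨hT, s, hs, hsc, hb⟩ := h
  refine ⟨s.toFinset, sᶜ.toFinset, ⟨hT, by simp, by simpa using hb⟩, ?_, ?_⟩
  · rw [← hs, Set.ncard_eq_toFinset_card']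
  · rw [← hsc, Set.ncard_eq_toFinset_card']

theorem IsBipTree.card_eq {T : SimpleGraph V} {p q : ℕ} (h : IsBipTree p q T) :
    Fintype.card V = p + q := by
  obtain ⟨-, s, hs, hsc, -⟩ := h
  rw [← hs, ← hsc, Set.ncard_add_ncard_compl, Nat.card_eq_fintype_card]

theorem IsBipTree.spectralMoment_two {T : SimpleGraph V} {p q : ℕ} (h : IsBipTree p q T) :
    spectralMoment T 2 = 2 * ((p : ℝ) + q) - 2 := by
  classical
  have h1 := h.1.card_edgeFinset
  rw [h.card_eq] at h1
  rw [SOrder.spectralMoment_two, ← Nat.cast_sum, T.sum_degrees_eq_twice_card_edges]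
  have : ((#T.edgeFinset : ℝ) + 1) = p + q := by exact_mod_cast h1
  push_cast
  linarith

theorem spectralMoment_eq_of_lt_four {W : Type*} [Fintype W] {T : SimpleGraph V}
    {U : SimpleGraph W} {p q : ℕ} (hT : IsBipTree p q T) (hU : IsBipTree p q U) {i : ℕ}
    (hi : i < 4) : spectralMoment T i = spectralMoment U i := by
  interval_cases i
  · rw [spectralMoment_zero, spectralMoment_zero, hT.card_eq, hU.card_eq]
  · rw [hT.2.spectralMoment_odd (by decide), hU.2.spectralMoment_odd (by decide)]
  · rw [hT.spectralMoment_two, hU.spectralMoment_two]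
  · rw [hT.2.spectralMoment_odd (by decide), hU.2.spectralMoment_odd (by decide)]

theorem SLt.of_four {W : Type*} [Fintype W] {T : SimpleGraph V} {U : SimpleGraph W} {p q : ℕ}
    (hT : IsBipTree p q T) (hU : IsBipTree p q U) (hn : 4 < p + q)
    (h : spectralMoment T 4 < spectralMoment U 4) : SLt T U :=
  ⟨hT.card_eq.trans hU.card_eq.symm, 4, by omega, by rwa [hT.card_eq],
    fun _ hi => spectralMoment_eq_of_lt_four hT hU hi, h⟩

namespace IsColoredTree

variable {T : SimpleGraph V} {s t : Finset V}

omit [Fintype V] in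
theorem symm (h : IsColoredTree T s t) : IsColoredTree T t s :=
  ⟨h.isTree, fun v => by rw [h.mem_iff, not_not], h.isBipartiteWith.symm⟩

omit [Fintype V] in
theorem coe_eq_compl (h : IsColoredTree T s t) : (t : Set V) = (s : Set V)ᶜ := by
  ext v; simp [h.mem_iff]

theorem card_add_card (h : IsColoredTree T s t) : #s + #t = Fintype.card V := by
  classical
  have : t = sᶜ := by ext v; simp [h.mem_iff]
  rw [this, Finset.card_add_card_compl]

theorem sum_add_sum (h : IsColoredTree T s t) {M : Type*} [AddCommMonoid M] (f : V → M) :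
    ∑ v ∈ s, f v + ∑ v ∈ t, f v = ∑ v, f v := by
  classical
  have : t = sᶜ := by ext v; simp [h.mem_iff]
  rw [this, Finset.sum_add_sum_compl]

variable [DecidableRel T.Adj]

theorem degree_pos (h : IsColoredTree T s t) (hs : s.Nonempty) (ht : t.Nonempty) (v : V) :
    0 < T.degree v := by
  obtain ⟨a, ha⟩ := hs
  obtain ⟨b, hb⟩ := ht
  have : Nontrivial V := ⟨a, b, fun hab => (h.mem_iff b).1 hb (hab ▸ ha)⟩
  exact h.isTree.connected.preconnected.degree_pos_of_nontrivial v

theorem sum_degree (h : IsColoredTree T s t) : ∑ v ∈ s, T.degree v + 1 = #s + #t := by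
  classical
  rw [SimpleGraph.isBipartiteWith_sum_degrees_eq_card_edges h.isBipartiteWith, h.card_add_card,
    h.isTree.card_edgeFinset]

/-- Every edge has exactly one end in `s`, so the degrees there sum to `#s + #t - 1`; each of the
`#s` vertices gives up one. -/
theorem sum_degree_sub_one (h : IsColoredTree T s t) (hs : s.Nonempty) (ht : t.Nonempty) :
    ∑ v ∈ s, (T.degree v - 1) + 1 = #t := by
  have h1 := h.sum_degree
  have h2 : ∑ v ∈ s, T.degree v = ∑ v ∈ s, (T.degree v - 1) + #s := by
    rw [Finset.card_eq_sum_ones, ← Finset.sum_add_distrib]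
    exact Finset.sum_congr rfl fun v _ => by have := h.degree_pos hs ht v; omega
  omega

theorem spectralMoment_four (h : IsColoredTree T s t) (hs : s.Nonempty) (ht : t.Nonempty) :
    spectralMoment T 4 = 2 * ((∑ v ∈ s, (T.degree v - 1) ^ 2 + ∑ v ∈ t, (T.degree v - 1) ^ 2 : ℕ) : ℝ)
      + 4 * (#s + #t) - 6 := by
  have h1 : ∀ v, (T.degree v : ℝ) = ((T.degree v - 1 : ℕ) : ℝ) + 1 := fun v => by
    have := h.degree_pos hs ht v
    exact_mod_cast (Nat.sub_add_cancel this).symm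
  have h2 := h.sum_add_sum fun v => T.degree v - 1
  have h3 := h.sum_degree_sub_one hs ht
  have h4 := h.symm.sum_degree_sub_one ht hs
  have h5 : (∑ v, ((T.degree v - 1 : ℕ) : ℝ)) + 2 = #s + #t := by
    rw [← Nat.cast_sum, ← h2]
    exact_mod_cast (by omega)
  have h6 : (Fintype.card V : ℝ) = #s + #t := by
    rw [← h.card_add_card]; push_cast; rfl
  rw [SOrder.spectralMoment_four h.isTree.isAcyclic, h.sum_add_sum]
  simp only [h1, add_sq, Finset.sum_add_distrib, Finset.sum_const, Finset.card_univ, nsmul_eq_mul,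
    h6, one_pow, mul_one, ← Finset.mul_sum, Nat.cast_sum, Nat.cast_pow]
  linarith

theorem adj_of_degree_eq (h : IsColoredTree T s t) {r : V} (hr : r ∈ s) (hdeg : T.degree r = #t)
    {b : V} (hb : b ∈ t) : T.Adj r b := by
  have h1 := SimpleGraph.isBipartiteWith_neighborFinset_subset h.isBipartiteWith hr
  have h2 := Finset.eq_of_subset_of_card_le h1 (by rw [T.card_neighborFinset_eq_degree, hdeg])
  rw [← T.mem_neighborFinset, h2]
  exact hb

theorem degree_le (h : IsColoredTree T s t) {r : V} (hr : r ∈ s) : T.degree r ≤ #t :=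
  SimpleGraph.isBipartiteWith_degree_le h.isBipartiteWith hr

/-- The hub uses up the whole excess `#t - 1` available in its class. -/
theorem degree_eq_one_of_hub (h : IsColoredTree T s t) {r : V} (hr : r ∈ s)
    (hdeg : T.degree r = #t) (ht : t.Nonempty) {w : V} (hw : w ∈ s) (hwr : w ≠ r) :
    T.degree w = 1 := by
  classical
  have h1 := h.sum_degree_sub_one ⟨r, hr⟩ ht
  rw [← Finset.add_sum_erase s _ hr, hdeg] at h1
  have h2 : ∑ v ∈ s.erase r, (T.degree v - 1) = 0 := by
    have := ht.card_pos
    omega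
  have h3 := Finset.sum_eq_zero_iff.1 h2 w (Finset.mem_erase.2 ⟨hwr, hw⟩)
  have := h.degree_pos ⟨r, hr⟩ ht w
  omega

theorem nonempty_iso_treeB (h : IsColoredTree T s t) {r : V} (hr : r ∈ s)
    (hdeg : T.degree r = #t) {k l : ℕ} {b₁ b₂ : V} (hb₁ : b₁ ∈ t) (hb₂ : b₂ ∈ t) (hb : b₁ ≠ b₂)
    (hdeg₂ : T.degree b₂ - 1 = k + l) (hdeg' : ∀ b ∈ t, b ≠ b₁ → b ≠ b₂ → T.degree b - 1 = 0)
    (hp : 1 + k + l ≤ #s) (hq : l + 2 ≤ #t) (hl : l ≤ 1) (hkl : k = 0 ∨ l = 0) :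
    Nonempty (T ≃g treeB #s #t k l) := by
  have hs : s.Nonempty := ⟨r, hr⟩
  have ht : t.Nonempty := ⟨b₁, hb₁⟩
  have hpos := h.degree_pos hs ht
  refine SOrder.nonempty_iso_treeB (s := s) (r := r) (h.coe_eq_compl ▸ h.isBipartiteWith) (by simp)
    (by rw [← h.coe_eq_compl]; simp) hr
    (fun b hb => h.adj_of_degree_eq hr hdeg ((h.mem_iff b).2 (by simpa using hb)))
    (fun w hw hwr => h.degree_eq_one_of_hub hr hdeg ht hw hwr) (b₁ := b₁) (b₂ := b₂)
    ((h.mem_iff _).1 hb₁) ((h.mem_iff _).1 hb₂) hb (by have := hpos b₂; omega)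
    (fun b hbs h1 h2 => ?_) hp hq hl hkl
  have := hdeg' b ((h.mem_iff b).2 (by simpa using hbs)) h1 h2
  have := hpos b
  omega

/-- A tree with a hub in each colour class. -/
theorem nonempty_iso_treeB_zero_zero (h : IsColoredTree T s t) {r r' : V} (hr : r ∈ s)
    (hdeg : T.degree r = #t) (hr' : r' ∈ t) (hdeg' : T.degree r' = #s) (ht : 2 ≤ #t) :
    Nonempty (T ≃g treeB #s #t 0 0) := by
  obtain ⟨b, hb, hne⟩ := Finset.exists_mem_ne (by omega : 1 < #t) r'
  have h0 : ∀ b ∈ t, b ≠ r' → T.degree b - 1 = 0 := fun b hb hbr => by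
    rw [h.symm.degree_eq_one_of_hub hr' hdeg' ⟨r, hr⟩ hb hbr]
  exact h.nonempty_iso_treeB hr hdeg hr' hb hne.symm (h0 b hb hne) (fun b hb h1 _ => h0 b hb h1)
    (by have := Finset.card_pos.2 ⟨r, hr⟩; omega) (by omega) (by omega) (by omega)

/-- The trees with a hub in `s` and without a hub in `t`, in order of the fourth moment. -/
theorem hub_cases (h : IsColoredTree T s t) {r : V} (hr : r ∈ s) (hdeg : T.degree r = #t)
    (hs : 4 ≤ #s) (ht : 3 ≤ #t) (hno : ∀ b ∈ t, T.degree b ≠ #s) :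
    Nonempty (T ≃g treeB #s #t 0 1) ∨ Nonempty (T ≃g treeB #s #t 2 0) ∨
      spectralMoment T 4 < spectralMoment (treeB #s #t 2 0) 4 := by
  classical
  have hs' : s.Nonempty := ⟨r, hr⟩
  have ht' : t.Nonempty := Finset.card_pos.1 (by omega)
  have hsum := h.symm.sum_degree_sub_one ht' hs'
  -- The excesses in `t` sum to `M + 2`, and a hub there would have all of it. Excess `M + 1` leads
  -- to `B^{0,1}`; a bound of `M` leads to `B^{2,0}` or below.
  obtain ⟨M, hM⟩ : ∃ M, #s = M + 3 := ⟨#s - 3, by omega⟩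
  have hle : ∀ b ∈ t, T.degree b - 1 ≤ M + 1 := fun b hb => by
    have := h.symm.degree_le hb
    have := hno b hb
    omega
  by_cases hex : ∃ b ∈ t, T.degree b - 1 = M + 1
  · left
    obtain ⟨b, hb, hbdeg⟩ := hex
    have h1 := Finset.add_sum_erase t (fun v => T.degree v - 1) hb
    have h2 : ∑ v ∈ t.erase b, (T.degree v - 1) = 1 := by omega
    obtain ⟨j, hj, hj1, hj0⟩ := exists_eq_of_sum_sq_eq (c := 1) one_pos h2 (by
      refine le_antisymm ((sum_sq_le_sq_sum _ _).trans (by rw [h2])) ?_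
      have h3 : ∑ v ∈ t.erase b, (T.degree v - 1) ≤ ∑ v ∈ t.erase b, (T.degree v - 1) ^ 2 :=
        Finset.sum_le_sum fun i _ => Nat.le_self_pow two_ne_zero _
      rwa [h2] at h3)
    rw [Finset.mem_erase] at hj
    exact h.nonempty_iso_treeB hr hdeg hb hj.2 hj.1.symm (by omega)
      (fun k hk hkb hkj => hj0 k (Finset.mem_erase.2 ⟨hkb, hk⟩) hkj) (by omega) (by omega)
      (by omega) (by omega)
  · right
    push Not at hex
    rcases sum_sq_le_of_le_sub_two (t := t) (x := fun v => T.degree v - 1) (M := M) (by omega)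
      (by omega) (fun b hb => by have := hle b hb; have := hex b hb; omega) with h4 | h4
    · right
      have h5 : ∑ v ∈ s, (T.degree v - 1) ^ 2 = (#t - 1) ^ 2 := by
        rw [Finset.sum_eq_single_of_mem r hr, hdeg]
        intro w hw hwr
        rw [h.degree_eq_one_of_hub hr hdeg ht' hw hwr]
        simp
      have h6 : ((∑ v ∈ t, (T.degree v - 1) ^ 2 : ℕ) : ℝ) < (M : ℝ) ^ 2 + 4 := by exact_mod_cast h4
      rw [h.spectralMoment_four hs' ht', spectralMoment_treeB_four (by omega) (by omega) (by omega)
        (by omega), h5, Nat.cast_add, Nat.cast_pow, Nat.cast_sub (by omega), hM]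
      push_cast at h6 ⊢
      nlinarith
    · left
      obtain ⟨i, hi, j, hj, hij, hj2, h0⟩ := h4
      exact h.nonempty_iso_treeB hr hdeg hi hj hij (by simpa using hj2) h0 (by omega) (by omega)
        (by omega) (by omega)

theorem spectralMoment_four_le_of_no_hub (h : IsColoredTree T s t) (hs : 2 ≤ #s) (ht : 2 ≤ #t)
    (hns : ∀ r ∈ s, T.degree r ≠ #t) (hnt : ∀ r ∈ t, T.degree r ≠ #s) :
    spectralMoment T 4 ≤ 2 * (((#t : ℝ) - 2) ^ 2 + 1 + ((#s - 2) ^ 2 + 1)) + 4 * (#s + #t) - 6 := by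
  have hs' : s.Nonempty := Finset.card_pos.1 (by omega)
  have ht' : t.Nonempty := Finset.card_pos.1 (by omega)
  have h1 := sum_sq_le_of_le_sub_one (t := s) (x := fun v => T.degree v - 1) (M := #t - 2)
    (by have := h.sum_degree_sub_one hs' ht'; omega)
    (fun v hv => by have := h.degree_le hv; have := hns v hv; omega)
  have h2 := sum_sq_le_of_le_sub_one (t := t) (x := fun v => T.degree v - 1) (M := #s - 2)
    (by have := h.symm.sum_degree_sub_one ht' hs'; omega)
    (fun v hv => by have := h.symm.degree_le hv; have := hnt v hv; omega)
  rw [h.spectralMoment_four hs' ht']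
  have h3 := Nat.cast_le (α := ℝ).2 (add_le_add h1 h2)
  rw [Nat.cast_add (_ ^ 2 + 1), Nat.cast_add (_ ^ 2), Nat.cast_add (_ ^ 2), Nat.cast_pow,
    Nat.cast_pow, Nat.cast_sub hs, Nat.cast_sub ht] at h3
  push_cast at h3 ⊢
  linarith

end IsColoredTree

end BipTree

/-! ### Comparison of the candidates and conclusion. -/

section Main

variable {V : Type*} [Fintype V] {T : SimpleGraph V} {p q : ℕ}

theorem isBipTree_treeB {k l : ℕ} (hp : 1 + k + l ≤ p) (hq : l + 2 ≤ q) (hl : l ≤ 1)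
    (hkl : k = 0 ∨ l = 0) : IsBipTree p q (treeB p q k l) :=
  ⟨treeB_isTree hp hq hl hkl, hasBipartition_treeB p q k l⟩

theorem isBipTree_treeD {k l : ℕ} (hq : 1 + k + l ≤ q) (hp : l + 2 ≤ p) (hl : l ≤ 1)
    (hkl : k = 0 ∨ l = 0) : IsBipTree p q (treeD p q k l) :=
  ⟨(treeDIso p q k l).isTree_iff.2 (treeB_isTree hq hp hl hkl),
    (hasBipartition_treeB q p k l).symm.of_iso (treeDIso p q k l)⟩

theorem InClass.cases (h : InClass p q T) (hp : 4 ≤ p) (hpq : p ≤ q) :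
    Nonempty (T ≃g treeB p q 2 0) ∨ (p < q ∧ Nonempty (T ≃g treeD p q 0 1)) ∨
      spectralMoment T 4 < spectralMoment (treeB p q 2 0) 4 := by
  classical
  obtain ⟨hT, h00, h01⟩ := h
  obtain ⟨s, t, hc, rfl, rfl⟩ := hT.exists_isColoredTree
  have hcast : (#s : ℝ) ≤ #t := by exact_mod_cast hpq
  have hcast4 : (4 : ℝ) ≤ #s := by exact_mod_cast hp
  by_cases hs : ∃ r ∈ s, T.degree r = #t
  · obtain ⟨r, hr, hdeg⟩ := hs
    by_cases ht : ∃ r ∈ t, T.degree r = #s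
    · obtain ⟨r', hr', hdeg'⟩ := ht
      exact absurd (hc.nonempty_iso_treeB_zero_zero hr hdeg hr' hdeg' (by omega)) h00
    · push Not at ht
      rcases hc.hub_cases hr hdeg hp (by omega) ht with h1 | h1 | h1
      · exact absurd h1 h01
      · exact Or.inl h1
      · exact Or.inr (Or.inr h1)
  · push Not at hs
    by_cases ht : ∃ r ∈ t, T.degree r = #s
    · obtain ⟨r, hr, hdeg⟩ := ht
      -- The gap is `8 * (#t - #s)`: it is better to place the hub in the smaller class.
      have h20 : spectralMoment (treeB #t #s 2 0) 4 ≤ spectralMoment (treeB #s #t 2 0) 4 := by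
        rw [spectralMoment_treeB_four (by omega) (by omega) (by omega) (by omega),
          spectralMoment_treeB_four (by omega) (by omega) (by omega) (by omega)]
        push_cast
        nlinarith
      rcases hc.symm.hub_cases hr hdeg (by omega) (by omega) hs with ⟨⟨e⟩⟩ | ⟨⟨e⟩⟩ | h1
      -- For equal class sizes, interchanging the colours turns this tree into the excluded
      -- `B^{0,1}`.
      · rcases hpq.lt_or_eq with hlt | heq
        · exact Or.inr (Or.inl ⟨hlt, ⟨e.trans (treeDIso _ _ _ _).symm⟩⟩)
        · rw [← heq] at e h01
          exact absurd ⟨e⟩ h01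
      · rcases hpq.lt_or_eq with hlt | heq
        · right; right
          have hlt' : (#s : ℝ) < #t := by exact_mod_cast hlt
          rw [spectralMoment_congr e,
            spectralMoment_treeB_four (by omega) (by omega) (by omega) (by omega),
            spectralMoment_treeB_four (by omega) (by omega) (by omega) (by omega)]
          push_cast
          nlinarith
        · rw [← heq] at e ⊢
          exact Or.inl ⟨e⟩
      · exact Or.inr (Or.inr (h1.trans_le h20))
    · push Not at ht
      right; right
      -- The bound falls short of the fourth moment of `B^{2,0}` by `4 * (#t - #s + 2)`.
      refine (hc.spectralMoment_four_le_of_no_hub (by omega) (by omega) hs ht).trans_lt ?_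
      rw [spectralMoment_treeB_four (by omega) (by omega) (by omega) (by omega)]
      push_cast
      nlinarith

theorem sLe_and_sEq_iff {W : Type*} [Fintype W] {U : SimpleGraph W}
    (h : Nonempty (T ≃g U) ∨ SLt T U) : SLe T U ∧ (SEq T U ↔ Nonempty (T ≃g U)) := by
  rcases h with ⟨⟨e⟩⟩ | h
  · exact ⟨Or.inr (.of_iso e), fun _ => ⟨e⟩, fun _ => .of_iso e⟩
  · exact ⟨Or.inl h, fun h' => absurd h' h.not_sEq, fun ⟨e⟩ => absurd (.of_iso e) h.not_sEq⟩

theorem spectralMoment_treeD_four {k l : ℕ} (hq : 1 + k + l ≤ q) (hp : l + 2 ≤ p) (hl : l ≤ 1)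
    (hkl : k = 0 ∨ l = 0) : spectralMoment (treeD p q k l) 4 = 2 * ((p : ℝ) ^ 2 + 2 * (q - 1 : ℝ) +
      ((q - 1 - (k + l) : ℝ) ^ 2 + (k + l : ℝ) ^ 2)) := by
  rw [spectralMoment_congr (treeDIso p q k l), spectralMoment_treeB_four hq hp hl hkl]

theorem spectralMoment_treeD_treeB_of_tie (hp : 4 ≤ p) (hpq : p < q)
    (h : (p : ℝ) = ((q : ℝ) + 4) / 2) :
    (∀ i, i < 6 → spectralMoment (treeD p q 0 1) i = spectralMoment (treeB p q 2 0) i) ∧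
      spectralMoment (treeD p q 0 1) 6 < spectralMoment (treeB p q 2 0) 6 := by
  have hD : IsBipTree p q (treeD p q 0 1) :=
    isBipTree_treeD (by omega) (by omega) (by omega) (by omega)
  have hB : IsBipTree p q (treeB p q 2 0) :=
    isBipTree_treeB (by omega) (by omega) (by omega) (by omega)
  have hq : (q : ℝ) = 2 * p - 4 := by linarith
  have hpq' : (p : ℝ) < q := by exact_mod_cast hpq
  refine ⟨fun i hi => ?_, ?_⟩
  · rcases lt_or_ge i 4 with h4 | h4
    · exact spectralMoment_eq_of_lt_four hD hB h4
    · interval_cases i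
      · rw [spectralMoment_treeD_four (by omega) (by omega) (by omega) (by omega),
          spectralMoment_treeB_four (by omega) (by omega) (by omega) (by omega), hq]
        push_cast
        ring
      · rw [hD.2.spectralMoment_odd (by decide), hB.2.spectralMoment_odd (by decide)]
  · rw [spectralMoment_congr (treeDIso p q 0 1),
      spectralMoment_treeB_six (by omega) (by omega) (by omega) (by omega),
      spectralMoment_treeB_six (by omega) (by omega) (by omega) (by omega), hq]
    push_cast
    -- After substituting `q = 2 * p - 4` the gap in `S_6` is `12 * (p - 3) * (p - 4)`; `p < q`
    -- forces `p > 4`.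
    have h3 : 0 < ((p : ℝ) - 3) * (p - 4) := mul_pos (by linarith) (by linarith)
    nlinarith

theorem not_nonempty_iso_of_spectralMoment_ne {W : Type*} [Fintype W] {U : SimpleGraph W} {k : ℕ}
    (h : spectralMoment T k ≠ spectralMoment U k) : ¬ Nonempty (T ≃g U) :=
  fun ⟨e⟩ => h (spectralMoment_congr e k)

/-- For `p = 4` the leaves of `B^{2,0}` split as 2 and 1, which is the excluded `B^{0,1}`; from `p =
5` on, `S_4` separates the trees. -/
theorem inClass_treeB_two_zero (hp : 5 ≤ p) (hpq : p ≤ q) : InClass p q (treeB p q 2 0) := by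
  have hp' : (5 : ℝ) ≤ p := by exact_mod_cast hp
  refine ⟨isBipTree_treeB (by omega) (by omega) (by omega) (by omega),
    not_nonempty_iso_of_spectralMoment_ne (k := 4) ?_,
    not_nonempty_iso_of_spectralMoment_ne (k := 4) ?_⟩ <;>
  · rw [spectralMoment_treeB_four (by omega) (by omega) (by omega) (by omega),
      spectralMoment_treeB_four (by omega) (by omega) (by omega) (by omega)]
    push_cast
    exact ne_of_lt (by nlinarith)

theorem inClass_treeD_zero_one (hp : 4 ≤ p) (hpq : p < q) : InClass p q (treeD p q 0 1) := by
  have hp' : (4 : ℝ) ≤ p := by exact_mod_cast hp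
  have hpq' : (p : ℝ) < q := by exact_mod_cast hpq
  refine ⟨isBipTree_treeD (by omega) (by omega) (by omega) (by omega),
    not_nonempty_iso_of_spectralMoment_ne (k := 4) ?_,
    not_nonempty_iso_of_spectralMoment_ne (k := 4) ?_⟩ <;>
  · rw [spectralMoment_treeD_four (by omega) (by omega) (by omega) (by omega),
      spectralMoment_treeB_four (by omega) (by omega) (by omega) (by omega)]
    push_cast
    exact ne_of_lt (by nlinarith)

theorem InClass.iso_or_sLt_treeD (h : InClass p q T) (hp : 4 ≤ p) (hpq : p < q)
    (hbig : (p : ℝ) > ((q : ℝ) + 4) / 2) :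
    Nonempty (T ≃g treeD p q 0 1) ∨ SLt T (treeD p q 0 1) := by
  have hD : IsBipTree p q (treeD p q 0 1) :=
    isBipTree_treeD (by omega) (by omega) (by omega) (by omega)
  -- The gap is `4 * (2 * p - q - 4)`, positive by `hbig`.
  have hlt : spectralMoment (treeB p q 2 0) 4 < spectralMoment (treeD p q 0 1) 4 := by
    rw [spectralMoment_treeD_four (by omega) (by omega) (by omega) (by omega),
      spectralMoment_treeB_four (by omega) (by omega) (by omega) (by omega)]
    push_cast
    nlinarith
  rcases h.cases hp hpq.le with ⟨⟨e⟩⟩ | ⟨-, h1⟩ | h1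
  · exact Or.inr (.of_four h.1 hD (by omega) (by rwa [spectralMoment_congr e]))
  · exact Or.inl h1
  · exact Or.inr (.of_four h.1 hD (by omega) (h1.trans hlt))

theorem InClass.iso_or_sLt_treeB (h : InClass p q T) (hp : 4 ≤ p) (hpq : p ≤ q)
    (hsmall : p < q → (p : ℝ) ≤ ((q : ℝ) + 4) / 2) :
    Nonempty (T ≃g treeB p q 2 0) ∨ SLt T (treeB p q 2 0) := by
  have hB : IsBipTree p q (treeB p q 2 0) :=
    isBipTree_treeB (by omega) (by omega) (by omega) (by omega)
  rcases h.cases hp hpq with h1 | ⟨hlt, ⟨e⟩⟩ | h1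
  · exact Or.inl h1
  · right
    rcases (hsmall hlt).lt_or_eq with hlt' | heq
    · refine .of_four h.1 hB (by omega) ?_
      rw [spectralMoment_congr e,
        spectralMoment_treeD_four (by omega) (by omega) (by omega) (by omega),
        spectralMoment_treeB_four (by omega) (by omega) (by omega) (by omega)]
      push_cast
      nlinarith
    · obtain ⟨h5, h6⟩ := spectralMoment_treeD_treeB_of_tie hp hlt heq
      exact ⟨h.1.card_eq.trans hB.card_eq.symm, 6, by omega, by rw [h.1.card_eq]; omega,
        fun i hi => (spectralMoment_congr e i).trans (h5 i hi),
        (spectralMoment_congr e 6).trans_lt h6⟩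
  · exact Or.inr (.of_four h.1 hB (by omega) h1)

end Main

end SOrder

theorem theorem2p3 (p q : ℕ) (hp : 4 ≤ p) (hpq : p ≤ q) :
    -- the upper bound and its equality case
    (∀ (V : Type*) [Fintype V] (T : SimpleGraph V), SOrder.InClass p q T →
      (p = q →
        SOrder.SLe T (SOrder.treeB p q 2 0) ∧
          (SOrder.SEq T (SOrder.treeB p q 2 0) ↔ Nonempty (T ≃g SOrder.treeB p q 2 0))) ∧
      (p < q →
        ((p : ℝ) > ((q : ℝ) + 4) / 2 →
          SOrder.SLe T (SOrder.treeD p q 0 1) ∧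
            (SOrder.SEq T (SOrder.treeD p q 0 1) ↔ Nonempty (T ≃g SOrder.treeD p q 0 1))) ∧
        ((p : ℝ) ≤ ((q : ℝ) + 4) / 2 →
          SOrder.SLe T (SOrder.treeB p q 2 0) ∧
            (SOrder.SEq T (SOrder.treeB p q 2 0) ↔ Nonempty (T ≃g SOrder.treeB p q 2 0))))) ∧
    -- the bound is attained within the class
    (5 ≤ p → SOrder.InClass p q (SOrder.treeB p q 2 0)) ∧
    ((p < q ∧ (p : ℝ) > ((q : ℝ) + 4) / 2) → SOrder.InClass p q (SOrder.treeD p q 0 1)) ∧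
    -- in the tie case the sixth moment is the first one to separate the two candidates
    ((p < q ∧ (p : ℝ) = ((q : ℝ) + 4) / 2) →
      (∀ i, i < 6 → SOrder.spectralMoment (SOrder.treeD p q 0 1) i =
        SOrder.spectralMoment (SOrder.treeB p q 2 0) i) ∧
      SOrder.spectralMoment (SOrder.treeD p q 0 1) 6 <
        SOrder.spectralMoment (SOrder.treeB p q 2 0) 6) := by
  refine ⟨fun V _ T hT => ⟨fun heq => ?_, fun hlt => ⟨fun hbig => ?_, fun hsmall => ?_⟩⟩,
    fun h5 => SOrder.inClass_treeB_two_zero h5 hpq,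
    fun h => SOrder.inClass_treeD_zero_one hp h.1,
    fun h => SOrder.spectralMoment_treeD_treeB_of_tie hp h.1 h.2⟩
  · exact SOrder.sLe_and_sEq_iff (hT.iso_or_sLt_treeB hp hpq fun hlt => absurd heq hlt.ne)
  · exact SOrder.sLe_and_sEq_iff (hT.iso_or_sLt_treeD hp hlt hbig)
  · exact SOrder.sLe_and_sEq_iff (hT.iso_or_sLt_treeB hp hpq fun _ => hsmall)
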